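/- Let $\mathcal U$ be the set of real numbers $q \ge 1$ for which there is exactly one sequence $(c_i)_{i\ge 1}$ of integers with $0 \le c_i \le q$ for all $i \ge 1$ and $\sum_{i=1}^{\infty} c_i q^{-i} = 1$; the elements of $\mathcal U$ are called univoque numbers. Let $\mathcal A$ be the set of univoque numbers that are algebraic over $\mathbb Q$, and let $\overline{\mathcal U}$ be the closure of $\mathcal U$ in $\mathbb R$. Then $\mathcal A$ is dense in $\overline{\mathcal U}$. -/

import Mathlib

/-- `c` is an expansion of `1` in base `q`: a sequence of integers `0 ≤ c i ≤ q` with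
`c 0 / q + c 1 / q ^ 2 + c 2 / q ^ 3 + ⋯ = 1` (the terms are indexed from `0`, so the paper's
`c_{i+1}` is `c i`). The terms are nonnegative, so `HasSum` is ordinary convergence of the
series to `1`. -/
def IsExpansion (q : ℝ) (c : ℕ → ℕ) : Prop :=
  (∀ i, (c i : ℝ) ≤ q) ∧ HasSum (fun i : ℕ => (c i : ℝ) / q ^ (i + 1)) 1

/-- The set `𝒰` of univoque numbers: the real `q ≥ 1` for which `1` has exactly one expansion. -/
def univoque : Set ℝ := {q | 1 ≤ q ∧ ∃! c : ℕ → ℕ, IsExpansion q c}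

/-- The set `𝒜` of algebraic univoque numbers. -/
def algebraicUnivoque : Set ℝ := {q | q ∈ univoque ∧ IsAlgebraic ℚ q}

/-!
Write `σ` for the shift of digit sequences and call `c i ↦ M - c i` the reflection. A univoque base
`q` is never an integer, so with `M = ⌊q⌋₊` we have `M < q < M + 1` and the digits are `0, …, M`.
For such `q` with expansion `c` of `1`, uniqueness is equivalent to `c 0 = M` together with: for
every `k ≥ 1`, both `σ^k c` and its reflection are lexicographically strictly smaller than `c`
(`LexAdmissible`; the two directions are `lexAdmissible_of_unique` and
`univoque_of_lexAdmissible`).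

It therefore suffices to approximate an admissible `c` by eventually periodic admissible sequences.
There are arbitrarily long prefixes `w` of `c` such that the reflection of each proper nonempty
suffix of `w` is strictly smaller than the prefix of the same length (`exists_goodPrefix`). Let `w⁻`
be `w` with its last digit lowered by one. Then `w` followed by the periodic repetition of the
reflection of `w⁻` is admissible (`lexAdmissible_periodicApprox`). It agrees with `c` on the whole
of `w`, so by the intermediate value theorem some base close to `q` gives it the value `1`; this
base is univoque, and by eventual periodicity it is a root of a monic polynomial
(`isAlgebraic_of_periodic`).
-/

open Filter Topology Finset

/-! ### Values of digit sequences -/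

/-- The value `∑ c i / q ^ (i + 1)` of the digit sequence `c` in base `q`. -/
noncomputable def digitVal (q : ℝ) (c : ℕ → ℕ) : ℝ := ∑' i, (c i : ℝ) / q ^ (i + 1)

/-- The strict lexicographic order on sequences of natural numbers. -/
def LexLt (a b : ℕ → ℕ) : Prop := ∃ j, (∀ i < j, a i = b i) ∧ a j < b j

/-- The lexicographic conditions that characterize the expansions of `1` in univoque bases between
`M` and `M + 1`: the first digit is the largest one, and every proper shift of `c`, as well as its
reflection, is strictly smaller than `c`. The shifts are compared after all digits, not only after
digits `< M` or `> 0`. The sequence that is constantly `M` fails `shift_lt`. -/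
structure LexAdmissible (M : ℕ) (c : ℕ → ℕ) : Prop where
  le : ∀ i, c i ≤ M
  zero : c 0 = M
  shift_lt : ∀ k, 1 ≤ k → LexLt (fun i => c (k + i)) c
  refl_lt : ∀ k, 1 ≤ k → LexLt (fun i => M - c (k + i)) c

section Value

variable {q : ℝ} {M : ℕ} {a b c : ℕ → ℕ}

theorem hasSum_const_digit (hq : 1 < q) (M : ℝ) :
    HasSum (fun i : ℕ => M / q ^ (i + 1)) (M / (q - 1)) := by
  have h0 : 0 < q := by linarith
  have h := (hasSum_geometric_of_lt_one (inv_nonneg.2 h0.le) (inv_lt_one_of_one_lt₀ hq)).mul_left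
    (M / q)
  have h1 : q - 1 ≠ 0 := by linarith
  have h2 : M / q * (1 - q⁻¹)⁻¹ = M / (q - 1) := by
    rw [← one_div q, one_sub_div h0.ne']
    field_simp
  rw [h2] at h
  refine h.congr_fun fun i => ?_
  rw [pow_succ, inv_pow]
  field_simp

theorem summable_digits (hq : 1 < q) (hc : ∀ i, c i ≤ M) :
    Summable (fun i : ℕ => (c i : ℝ) / q ^ (i + 1)) := by
  have h0 : 0 < q := by linarith
  refine Summable.of_nonneg_of_le (fun i => by positivity) (fun i => ?_)
    (hasSum_const_digit hq (M : ℝ)).summable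
  have : (c i : ℝ) ≤ M := by exact_mod_cast hc i
  gcongr

theorem digitVal_nonneg (hq : 1 < q) : 0 ≤ digitVal q c :=
  tsum_nonneg fun i => by have : 0 < q := by linarith
                          positivity

theorem digitVal_le (hq : 1 < q) (hc : ∀ i, c i ≤ M) : digitVal q c ≤ M / (q - 1) := by
  have h0 : 0 < q := by linarith
  rw [← (hasSum_const_digit hq (M : ℝ)).tsum_eq]
  refine (summable_digits hq hc).tsum_le_tsum (fun i => ?_)
    (hasSum_const_digit hq (M : ℝ)).summable
  have : (c i : ℝ) ≤ M := by exact_mod_cast hc i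
  gcongr

theorem digitVal_pos (hq : 1 < q) (hc : ∀ i, c i ≤ M) {j : ℕ} (hj : 0 < c j) :
    0 < digitVal q c := by
  have h0 : 0 < q := by linarith
  have hj' : (0 : ℝ) < c j := by exact_mod_cast hj
  exact (summable_digits hq hc).tsum_pos (fun i => by positivity) j (by positivity)

theorem digitVal_refl (hq : 1 < q) (hc : ∀ i, c i ≤ M) :
    digitVal q (fun i => M - c i) = M / (q - 1) - digitVal q c := by
  refine (((hasSum_const_digit hq (M : ℝ)).sub
    (summable_digits hq hc).hasSum).congr_fun fun i => ?_).tsum_eq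
  rw [Nat.cast_sub (hc i), sub_div]

theorem digitVal_split (hq : 1 < q) (hc : ∀ i, c i ≤ M) (n : ℕ) :
    digitVal q c = ∑ i ∈ range n, (c i : ℝ) / q ^ (i + 1)
      + digitVal q (fun i => c (n + i)) / q ^ n := by
  rw [digitVal, ← (summable_digits hq hc).sum_add_tsum_nat_add n, digitVal, ← tsum_div_const]
  congr 1
  refine tsum_congr fun i => ?_
  rw [div_div, ← pow_add, add_comm n i]
  congr 2
  omega

theorem digitVal_succ (hq : 1 < q) (hc : ∀ i, c i ≤ M) (k : ℕ) :
    digitVal q (fun i => c (k + 1 + i)) = q * digitVal q (fun i => c (k + i)) - c k := by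
  have h0 : 0 < q := by linarith
  rw [digitVal_split (c := fun i => c (k + i)) hq (fun i => hc _) 1]
  simp only [range_one, sum_singleton, add_zero, zero_add, pow_one, add_assoc]
  field_simp
  ring

theorem digitVal_sub_of_agree (hq : 1 < q) (ha : ∀ i, a i ≤ M) (hb : ∀ i, b i ≤ M) {n : ℕ}
    (h : ∀ i < n, a i = b i) :
    digitVal q a - digitVal q b
      = (digitVal q (fun i => a (n + i)) - digitVal q (fun i => b (n + i))) / q ^ n := by
  rw [digitVal_split hq ha n, digitVal_split hq hb n,
    sum_congr rfl fun i hi => by rw [h i (mem_range.1 hi)]]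
  ring

theorem digitVal_sub_of_agree_succ (hq : 1 < q) (ha : ∀ i, a i ≤ M) (hb : ∀ i, b i ≤ M) {j : ℕ}
    (h : ∀ i < j, a i = b i) :
    digitVal q a - digitVal q b
      = ((a j : ℝ) - b j + digitVal q (fun i => a (j + 1 + i))
          - digitVal q (fun i => b (j + 1 + i))) / q ^ (j + 1) := by
  have h0 : 0 < q := by linarith
  rw [digitVal_sub_of_agree hq ha hb h, digitVal_succ hq ha, digitVal_succ hq hb]
  field_simp
  ring

theorem exists_first_ne (h : a ≠ b) : ∃ j, (∀ i < j, a i = b i) ∧ a j ≠ b j := by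
  classical
  have h' := Function.ne_iff.1 h
  exact ⟨Nat.find h', fun i hi => not_not.1 (Nat.find_min h' hi), Nat.find_spec h'⟩

/-- With digits `0, …, M`, every number in `[0, M / (q - 1)]` is represented in base
`q ≤ M + 1`; the digits come from the greedy algorithm. -/
theorem exists_digits (hq : 1 < q) (hqM : q ≤ M + 1) {x : ℝ} (hx0 : 0 ≤ x)
    (hx : x ≤ M / (q - 1)) : ∃ e : ℕ → ℕ, (∀ i, e i ≤ M) ∧ digitVal q e = x := by
  have h0 : 0 < q := by linarith
  have h1 : 0 < q - 1 := by linarith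
  let dig : ℝ → ℕ := fun y => min M ⌊q * y⌋₊
  let r : ℕ → ℝ := fun n => (fun y => q * y - dig y)^[n] x
  have hr : ∀ n, r (n + 1) = q * r n - dig (r n) := fun n =>
    Function.iterate_succ_apply' _ _ _
  have hr01 : ∀ n, 0 ≤ r n ∧ r n ≤ M / (q - 1) := by
    intro n
    induction n with
    | zero => exact ⟨hx0, hx⟩
    | succ n ih =>
      obtain ⟨i1, i2⟩ := ih
      have hqr : 0 ≤ q * r n := by positivity
      rw [hr]
      constructor
      · have : (dig (r n) : ℝ) ≤ ⌊q * r n⌋₊ := by exact_mod_cast min_le_right _ _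
        have := Nat.floor_le hqr
        linarith
      · rw [le_div_iff₀ h1] at i2 ⊢
        rcases le_total M ⌊q * r n⌋₊ with h | h
        · have : dig (r n) = M := min_eq_left h
          rw [this]
          nlinarith
        · have : dig (r n) = ⌊q * r n⌋₊ := min_eq_right h
          rw [this]
          have := Nat.lt_floor_add_one (q * r n)
          nlinarith
  have hsum : ∀ n, ∑ i ∈ range n, (dig (r i) : ℝ) / q ^ (i + 1) = x - r n / q ^ n := by
    intro n
    induction n with
    | zero => simp [r]
    | succ n ih =>
      rw [sum_range_succ, ih, hr]
      field_simp
      ring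
  refine ⟨fun i => dig (r i), fun i => min_le_left _ _, ?_⟩
  refine HasSum.tsum_eq ((hasSum_iff_tendsto_nat_of_nonneg (fun i => by positivity) _).2 ?_)
  simp only [hsum]
  have hlim : Tendsto (fun n => M / (q - 1) * (q⁻¹) ^ n) atTop (𝓝 (M / (q - 1) * 0)) :=
    (tendsto_pow_atTop_nhds_zero_of_lt_one (inv_nonneg.2 h0.le)
      (inv_lt_one_of_one_lt₀ hq)).const_mul _
  rw [mul_zero] at hlim
  have : Tendsto (fun n => r n / q ^ n) atTop (𝓝 0) := by
    refine squeeze_zero (fun n => div_nonneg (hr01 n).1 (by positivity)) (fun n => ?_) hlim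
    rw [inv_pow, ← div_eq_mul_inv]
    exact div_le_div_of_nonneg_right (hr01 n).2 (by positivity)
  simpa using tendsto_const_nhds.sub this

end Value

/-! ### The lexicographic criterion for uniqueness -/

section Criterion

variable {q : ℝ} {M : ℕ} {c : ℕ → ℕ}

theorem isExpansion_iff (hq : 1 < q) (h1 : (M : ℝ) < q) (h2 : q < M + 1) :
    IsExpansion q c ↔ (∀ i, c i ≤ M) ∧ digitVal q c = 1 := by
  have hle : (∀ i, (c i : ℝ) ≤ q) ↔ ∀ i, c i ≤ M := by
    refine forall_congr' fun i => ⟨fun h => ?_, fun h => ?_⟩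
    · have : (c i : ℝ) < (M + 1 : ℕ) := by push_cast; linarith
      exact Nat.lt_succ_iff.1 (by exact_mod_cast this)
    · have : (c i : ℝ) ≤ M := by exact_mod_cast h
      linarith
  unfold IsExpansion
  rw [hle]
  refine and_congr_right fun h => ?_
  exact (summable_digits hq h).hasSum_iff

theorem not_univoque_natCast {N : ℕ} : (N : ℝ) ∉ univoque := by
  rintro ⟨h1, c, -, hc⟩
  have hN : (N : ℝ) ≠ 0 := by linarith
  have hN1 : 1 ≤ N := by exact_mod_cast h1
  -- `1 = N / N` and `1 = (N - 1) / N + N / N ^ 2` are two expansions.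
  have e1 : IsExpansion N (fun i => if i = 0 then N else 0) := by
    refine ⟨fun i => by dsimp only; split_ifs <;> simp, ?_⟩
    refine (hasSum_ite_eq (0 : ℕ) (1 : ℝ)).congr_fun fun i => ?_
    by_cases h : i = 0
    · simp [h, hN]
    · simp only [h, if_false, Nat.cast_zero, zero_div]
  have e2 : IsExpansion N (fun i => if i = 0 then N - 1 else if i = 1 then N else 0) := by
    refine ⟨fun i => by dsimp only; split_ifs <;> simp, ?_⟩
    have := hasSum_sum_of_ne_finset_zero (s := range 2) (L := .unconditional ℕ)
      (f := fun i : ℕ => ((if i = 0 then N - 1 else if i = 1 then N else 0 : ℕ) : ℝ)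
        / (N : ℝ) ^ (i + 1)) (by
        intro i hi
        simp only [mem_range, not_lt] at hi
        rw [if_neg (by omega), if_neg (by omega)]
        simp)
    convert this using 1
    simp only [sum_range_succ, range_zero, sum_empty]
    simp [Nat.cast_sub hN1]
    field_simp
    ring
  have := congrFun ((hc _ e1).trans (hc _ e2).symm) 0
  simp at this
  omega

/-- A digit of a unique expansion cannot be changed: if changing the `n`-th digit to `v` leaves a
remainder `y` that can be represented by the later digits, there is a second expansion. -/
theorem false_of_replace_digit (hq : 1 < q) (h1 : (M : ℝ) < q) (h2 : q < M + 1)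
    (hc : IsExpansion q c) (huniq : ∀ c', IsExpansion q c' → c' = c) {n v : ℕ} (hv : v ≤ M)
    (hvn : v ≠ c n) {y : ℝ} (hy0 : 0 ≤ y) (hy : y ≤ M / (q - 1))
    (h : v + y = c n + digitVal q (fun i => c (n + 1 + i))) : False := by
  obtain ⟨hcM, hc1⟩ := (isExpansion_iff hq h1 h2).1 hc
  obtain ⟨e, heM, hey⟩ := exists_digits hq h2.le hy0 hy
  let c' : ℕ → ℕ := fun i => if i < n then c i else if i = n then v else e (i - (n + 1))
  have hc'M : ∀ i, c' i ≤ M := fun i => by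
    dsimp only [c']
    split_ifs
    exacts [hcM i, hv, heM _]
  have hn : c' n = v := by simp [c']
  have htail : (fun i => c' (n + 1 + i)) = e := by
    funext i
    dsimp only [c']
    rw [if_neg (by omega), if_neg (by omega)]
    congr 1
    omega
  have hd := digitVal_sub_of_agree_succ (a := c') (b := c) hq hc'M hcM (j := n)
    (fun i hi => by simp [c', hi])
  rw [hn, htail, hey, hc1, show (v : ℝ) - c n + y - digitVal q (fun i => c (n + 1 + i)) = 0 by
    linarith, zero_div] at hd
  have := huniq c' ((isExpansion_iff hq h1 h2).2 ⟨hc'M, sub_eq_zero.1 hd⟩)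
  exact hvn (by rw [← hn, this])

theorem lexLt_of_digitVal_lt_one (hq : 1 < q) (hcM : ∀ i, c i ≤ M) (hc1 : digitVal q c = 1)
    (htail : ∀ n, 1 ≤ n → digitVal q (fun i => c (n + i)) < 1) {f : ℕ → ℕ} (hf : ∀ i, f i ≤ M)
    (hf1 : digitVal q f < 1) : LexLt f c := by
  have hne : f ≠ c := fun h => by rw [h, hc1] at hf1; exact lt_irrefl _ hf1
  obtain ⟨j, hj, hne⟩ := exists_first_ne hne
  refine ⟨j, hj, lt_of_le_of_ne (le_of_not_gt fun hlt => ?_) hne⟩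
  have hd := digitVal_sub_of_agree_succ hq hf hcM hj
  have h3 := htail (j + 1) (by omega)
  have h4 : 0 ≤ digitVal q (fun i => f (j + 1 + i)) := digitVal_nonneg hq
  have h5 : (c j : ℝ) + 1 ≤ f j := by exact_mod_cast hlt
  have h6 : 0 ≤ digitVal q f - digitVal q c := by
    rw [hd]
    exact div_nonneg (by linarith) (by positivity)
  linarith

theorem lexAdmissible_of_unique (hM : 1 ≤ M) (h1 : (M : ℝ) < q) (h2 : q < M + 1)
    (hc : IsExpansion q c) (huniq : ∀ c', IsExpansion q c' → c' = c) : LexAdmissible M c := by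
  have hM' : (1 : ℝ) ≤ M := by exact_mod_cast hM
  have hq : 1 < q := by linarith
  obtain ⟨hcM, hc1⟩ := (isExpansion_iff hq h1 h2).1 hc
  have hsh : ∀ n, c n < M → digitVal q (fun i => c (n + 1 + i)) < 1 := by
    intro n hn
    by_contra! hge
    refine false_of_replace_digit hq h1 h2 hc huniq (n := n) (v := c n + 1) hn (by omega)
      (y := digitVal q (fun i => c (n + 1 + i)) - 1) (by linarith) ?_ (by push_cast; ring)
    have := digitVal_le (c := fun i => c (n + 1 + i)) hq (fun i => hcM _)
    linarith
  have hre : ∀ n, 0 < c n → digitVal q (fun i => M - c (n + 1 + i)) < 1 := by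
    intro n hn
    by_contra! hge
    rw [digitVal_refl (c := fun i => c (n + 1 + i)) hq (fun i => hcM _)] at hge
    refine false_of_replace_digit hq h1 h2 hc huniq (n := n) (v := c n - 1)
      ((Nat.sub_le _ _).trans (hcM n)) (by omega)
      (y := digitVal q (fun i => c (n + 1 + i)) + 1) ?_ (by linarith)
      (by push_cast [Nat.cast_sub (show 1 ≤ c n from hn)]; ring)
    have : 0 ≤ digitVal q (fun i => c (n + 1 + i)) := digitVal_nonneg hq
    linarith
  have hshift : ∀ n, digitVal q (fun i => c (n + i)) ≤ 1 →
      digitVal q (fun i => c (n + 1 + i)) < 1 := by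
    intro n hn
    rcases (hcM n).lt_or_eq with h | h
    · exact hsh n h
    · -- The next shift has value at most `q - M`, and `q < M + 1`.
      rw [digitVal_succ hq hcM, h]
      nlinarith
  have hshift' : ∀ n, digitVal q (fun i => c (n + 1 + i)) < 1 := by
    intro n
    induction n with
    | zero => exact hshift 0 (by simp [hc1])
    | succ n ih => exact hshift _ ih.le
  have hc0 : c 0 = M := by
    refine le_antisymm (hcM 0) (le_of_not_gt fun hlt => ?_)
    have h3 := hsh 0 hlt
    rw [digitVal_succ hq hcM] at h3
    simp only [zero_add, hc1] at h3
    have : (c 0 : ℝ) + 1 ≤ M := by exact_mod_cast hlt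
    linarith
  have hrefl' : ∀ n, digitVal q (fun i => M - c (n + 1 + i)) < 1 := by
    intro n
    induction n with
    | zero => exact hre 0 (by omega)
    | succ n ih =>
      rcases Nat.eq_zero_or_pos (c (n + 1)) with h | h
      · rw [digitVal_succ (c := fun i => M - c i) (M := M) hq (fun i => Nat.sub_le _ _), h]
        simp only [Nat.sub_zero]
        nlinarith
      · exact hre _ h
  have htail : ∀ n, 1 ≤ n → digitVal q (fun i => c (n + i)) < 1 := fun n hn => by
    obtain ⟨n, rfl⟩ := Nat.exists_eq_add_of_le' hn
    exact hshift' n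
  refine ⟨hcM, hc0, fun k hk => ?_, fun k hk => ?_⟩
  · exact lexLt_of_digitVal_lt_one hq hcM hc1 htail (fun i => hcM _) (htail k hk)
  · obtain ⟨k, rfl⟩ := Nat.exists_eq_add_of_le' hk
    exact lexLt_of_digitVal_lt_one hq hcM hc1 htail (fun i => Nat.sub_le _ _) (hrefl' k)

/-- If every proper shift of `e` is lexicographically smaller than the expansion `c` of `1`, then
these shifts have value less than `1`. It is applied to `e = c` and to the reflection of `c`. -/
theorem digitVal_shift_lt_one (hq : 1 < q) (hcM : ∀ i, c i ≤ M) (hc1 : digitVal q c = 1)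
    (hpos : ∀ n, 1 ≤ n → 0 < digitVal q (fun i => c (n + i))) {e : ℕ → ℕ} (he : ∀ i, e i ≤ M)
    (hlex : ∀ m, 1 ≤ m → LexLt (fun i => e (m + i)) c) {m : ℕ} (hm : 1 ≤ m) :
    digitVal q (fun i => e (m + i)) < 1 := by
  have h0 : 0 < q := by linarith
  -- Comparing at the first difference, a value of a shift exceeds `1` by less than a `q`-power
  -- fraction of the excess of a later shift. As the excesses are bounded, none is positive.
  have step : ∀ m, 1 ≤ m → ∃ j m', 1 ≤ m' ∧ digitVal q (fun i => e (m + i)) - 1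
      < (digitVal q (fun i => e (m' + i)) - 1) / q ^ (j + 1) := by
    intro m hm
    obtain ⟨j, hj, hlt⟩ := hlex m hm
    refine ⟨j, m + (j + 1), by omega, ?_⟩
    have hd := digitVal_sub_of_agree_succ hq (fun i => he (m + i)) hcM hj
    rw [hc1] at hd
    rw [hd]
    have h3 := hpos (j + 1) (by omega)
    have h4 : (e (m + j) : ℝ) + 1 ≤ c j := by exact_mod_cast hlt
    simp only [← add_assoc] at h3 ⊢
    exact div_lt_div_of_pos_right (by linarith) (pow_pos h0 _)
  have bound : ∀ t m, 1 ≤ m → digitVal q (fun i => e (m + i)) - 1 ≤ M / (q - 1) / q ^ t := by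
    intro t
    induction t with
    | zero =>
      intro m _
      have := digitVal_le (c := fun i => e (m + i)) hq (fun i => he _)
      simp only [pow_zero, div_one]
      linarith
    | succ t ih =>
      intro m hm
      obtain ⟨j, m', hm', hlt⟩ := step m hm
      refine hlt.le.trans ((div_le_div_of_nonneg_right (ih m' hm') (by positivity)).trans ?_)
      rw [div_div, ← pow_add]
      have : 0 ≤ (M : ℝ) / (q - 1) := div_nonneg (by positivity) (by linarith)
      gcongr
      · exact hq.le
      · omega
  have hle : ∀ m, 1 ≤ m → digitVal q (fun i => e (m + i)) - 1 ≤ 0 := by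
    intro m hm
    have hlim : Tendsto (fun t : ℕ => M / (q - 1) / q ^ t) atTop (𝓝 0) :=
      tendsto_const_nhds.div_atTop (tendsto_pow_atTop_atTop_of_one_lt hq)
    exact ge_of_tendsto' hlim fun t => bound t m hm
  obtain ⟨j, m', hm', hlt⟩ := step m hm
  have := div_nonpos_of_nonpos_of_nonneg (hle m' hm') (pow_nonneg h0.le (j + 1))
  linarith

/-- At the first place where a second expansion differs from `c`, its digit is too large if the
tail of `c` has value less than `1`, and too small if the reflected tail has. -/
theorem univoque_of_lexAdmissible (hM : 1 ≤ M) (h1 : (M : ℝ) < q) (h2 : q < M + 1)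
    (hc : LexAdmissible M c) (hc1 : digitVal q c = 1) : q ∈ univoque := by
  have hM' : (1 : ℝ) ≤ M := by exact_mod_cast hM
  have hq : 1 < q := by linarith
  have hpos : ∀ n, 1 ≤ n → 0 < digitVal q (fun i => c (n + i)) := by
    intro n hn
    obtain ⟨j, -, hj⟩ := hc.refl_lt n hn
    have := hc.le j
    exact digitVal_pos hq (fun i => hc.le _) (j := j) (by dsimp only at hj; omega)
  have hsh : ∀ n, 1 ≤ n → digitVal q (fun i => c (n + i)) < 1 := fun n hn =>
    digitVal_shift_lt_one hq hc.le hc1 hpos hc.le hc.shift_lt hn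
  have hre : ∀ n, 1 ≤ n → digitVal q (fun i => M - c (n + i)) < 1 := fun n hn =>
    digitVal_shift_lt_one (e := fun i => M - c i) hq hc.le hc1 hpos (fun i => Nat.sub_le _ _)
      hc.refl_lt hn
  refine ⟨hq.le, c, (isExpansion_iff hq h1 h2).2 ⟨hc.le, hc1⟩, fun f hf => ?_⟩
  obtain ⟨hfM, hf1⟩ := (isExpansion_iff hq h1 h2).1 hf
  by_contra hne
  obtain ⟨j, hj, hne⟩ := exists_first_ne hne
  have hd := digitVal_sub_of_agree_succ hq hfM hc.le hj
  rw [hf1, hc1, sub_self, eq_comm, div_eq_zero_iff,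
    or_iff_left (pow_pos (by linarith : (0 : ℝ) < q) _).ne'] at hd
  have h3 := hsh (j + 1) (by omega)
  have h4 := hre (j + 1) (by omega)
  rw [digitVal_refl (c := fun i => c (j + 1 + i)) hq (fun i => hc.le _)] at h4
  have h5 : 0 ≤ digitVal q (fun i => f (j + 1 + i)) := digitVal_nonneg hq
  have h6 := digitVal_le (c := fun i => f (j + 1 + i)) hq (fun i => hfM _)
  rcases lt_or_gt_of_ne hne with h | h
  · have : (f j : ℝ) + 1 ≤ c j := by exact_mod_cast h
    linarith
  · have : (c j : ℝ) + 1 ≤ f j := by exact_mod_cast h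
    linarith

end Criterion

/-! ### Eventually periodic approximations -/

section Approximation

variable {M : ℕ} {c : ℕ → ℕ}

/-- The word `c 0 ⋯ c (n - 1)` is *good*: the reflection of each of its proper nonempty suffixes
is lexicographically strictly smaller than the prefix of the same length. -/
def GoodPrefix (M : ℕ) (c : ℕ → ℕ) (n : ℕ) : Prop :=
  ∀ k, 1 ≤ k → k < n →
    ∃ j, k + j < n ∧ (∀ i < j, M - c (k + i) = c i) ∧ M - c (k + j) < c j

/-- Suppose all prefixes of length at least `N` are bad. Among all their suffixes whose reflection is
a prefix of `c`, take one with the earliest starting point `k`, and extend the prefix up to and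
including the place where this reflected agreement breaks off. The longer prefix is bad as well, so
it has such a suffix starting at some `k' > k`; reflecting twice, `σ^(k' - k) c` exceeds `c`. -/
theorem exists_goodPrefix (hc : LexAdmissible M c) (N : ℕ) : ∃ n, N ≤ n ∧ GoodPrefix M c n := by
  classical
  by_contra! hbad
  have hP : ∀ n, N ≤ n → ∃ k, 1 ≤ k ∧ k < n ∧ ∀ i, k + i < n → M - c (k + i) = c i := by
    intro n hn
    have := hbad n hn
    unfold GoodPrefix at this
    push Not at this
    obtain ⟨k, hk, hkn, h⟩ := this
    refine ⟨k, hk, hkn, fun i => ?_⟩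
    obtain ⟨j0, hj0, hj0'⟩ := hc.refl_lt k hk
    induction i using Nat.strong_induction_on with
    | _ i ih =>
      intro hi
      rcases lt_or_ge i j0 with hlt | hge
      · exact hj0 i hlt
      · have hj0n : k + j0 < n := by omega
        exact absurd hj0' (not_lt.2 (h j0 hj0n hj0))
  have hex : ∃ k, 1 ≤ k ∧ ∃ n, N ≤ n ∧ k < n ∧ ∀ i, k + i < n → M - c (k + i) = c i := by
    obtain ⟨k, h1, h2, h3⟩ := hP N le_rfl
    exact ⟨k, h1, N, le_rfl, h2, h3⟩
  obtain ⟨hk1, n, hNn, hkn, hov⟩ := Nat.find_spec hex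
  set k := Nat.find hex with hk
  obtain ⟨j, hj, hjlt⟩ := hc.refl_lt k hk1
  dsimp only at hj hjlt
  have hnj : n ≤ k + j := by
    by_contra! h
    exact hjlt.ne (hov j h)
  obtain ⟨k', hk'1, hk'n, hov'⟩ := hP (k + j + 1) (by omega)
  have hle : k ≤ k' := Nat.find_min' hex ⟨hk'1, k + j + 1, by omega, hk'n, hov'⟩
  rcases hle.eq_or_lt with heq | hlt
  · have := hov' j (by omega)
    rw [← heq] at this
    omega
  · obtain ⟨s, rfl⟩ := Nat.exists_eq_add_of_lt hlt
    obtain ⟨t, ht⟩ := Nat.exists_eq_add_of_le (show s + 1 ≤ j by omega)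
    obtain ⟨l, hl, hllt⟩ := hc.shift_lt (s + 1) (by omega)
    dsimp only at hl hllt
    -- The block after `k + s + 1` reflects both a prefix of `c` and, up to its last digit, the block
    -- after `s + 1`, so `c` shifted by `s + 1` agrees with `c` before `t` and exceeds it at `t`.
    have heqs : ∀ i < t, c (s + 1 + i) = c i := by
      intro i hi
      have e1 := hj (s + 1 + i) (by omega)
      have e2 := hov' i (by omega)
      rw [show k + (s + 1 + i) = k + s + 1 + i by ring] at e1
      omega
    have hgt : c t < c (s + 1 + t) := by
      have e2 := hov' t (by omega)
      subst ht
      rw [show k + (s + 1 + t) = k + s + 1 + t by ring] at hjlt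
      omega
    rcases lt_trichotomy l t with h | h | h
    · exact hllt.ne (heqs l h)
    · subst h; omega
    · exact hgt.ne' (hl t h)

/-- The word `c 0 ⋯ c (n - 1)` with its last digit lowered by one, repeated periodically. -/
def loweredPeriod (c : ℕ → ℕ) (n i : ℕ) : ℕ :=
  if i % n = n - 1 then c (i % n) - 1 else c (i % n)

/-- The word `c 0 ⋯ c (n - 1)` followed by the reflection of `loweredPeriod c n`. -/
def periodicApprox (M : ℕ) (c : ℕ → ℕ) (n i : ℕ) : ℕ :=
  if i < n then c i else M - loweredPeriod c n (i - n)

theorem loweredPeriod_of_lt {n i : ℕ} (hi : i + 1 < n) : loweredPeriod c n i = c i := by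
  unfold loweredPeriod
  rw [Nat.mod_eq_of_lt (by omega), if_neg (by omega)]

theorem loweredPeriod_last {n i : ℕ} (hi : i + 1 = n) : loweredPeriod c n i = c i - 1 := by
  unfold loweredPeriod
  rw [Nat.mod_eq_of_lt (by omega), if_pos (by omega)]

theorem loweredPeriod_add_right (n i : ℕ) :
    loweredPeriod c n (n + i) = loweredPeriod c n i := by
  simp [loweredPeriod]

theorem loweredPeriod_mod_add (n s i : ℕ) :
    loweredPeriod c n (s % n + i) = loweredPeriod c n (s + i) := by
  simp [loweredPeriod]

theorem loweredPeriod_le (hc : ∀ i, c i ≤ M) (n i : ℕ) : loweredPeriod c n i ≤ M := by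
  unfold loweredPeriod
  have := hc (i % n)
  split_ifs <;> omega

theorem periodicApprox_of_lt {n i : ℕ} (hi : i < n) : periodicApprox M c n i = c i := if_pos hi

theorem periodicApprox_add (n i : ℕ) :
    periodicApprox M c n (n + i) = M - loweredPeriod c n i := by
  rw [periodicApprox, if_neg (by omega), Nat.add_sub_cancel_left]

theorem periodicApprox_le (hc : ∀ i, c i ≤ M) (n i : ℕ) : periodicApprox M c n i ≤ M := by
  unfold periodicApprox
  split_ifs
  exacts [hc i, Nat.sub_le _ _]

/-- A shift of the approximation is compared with it on the rest of the current block. If the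
lowered last digit, or the end of `w`, leaves a tie there, the next block, which begins with the
reflection of a prefix of `w` shorter than `w`, decides by the goodness of `w`. -/
theorem lexAdmissible_periodicApprox (hM : 1 ≤ M) (hc : LexAdmissible M c) {n : ℕ} (hn : 2 ≤ n)
    (hgood : GoodPrefix M c n) : LexAdmissible M (periodicApprox M c n) := by
  have hle := hc.le
  have hlast : 0 < c (n - 1) := by
    obtain ⟨j, hj, -, hlt⟩ := hgood (n - 1) (by omega) (by omega)
    obtain rfl : j = 0 := by omega
    have := hc.zero
    simp only [add_zero] at hlt
    omega
  -- the reflected prefix is smaller than the suffix that starts at `n - k`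
  have hsuf : ∀ k, 1 ≤ k → k < n → ∃ j < k,
      (∀ i < j, M - loweredPeriod c n i = periodicApprox M c n (n - k + i)) ∧
      M - loweredPeriod c n j < periodicApprox M c n (n - k + j) := by
    intro k hk hkn
    obtain ⟨j, hj, heq, hlt⟩ := hgood (n - k) (by omega) (by omega)
    refine ⟨j, by omega, fun i hi => ?_, ?_⟩
    · rw [loweredPeriod_of_lt (by omega), periodicApprox_of_lt (by omega)]
      have := heq i hi
      have := hle (n - k + i)
      omega
    · rw [loweredPeriod_of_lt (by omega), periodicApprox_of_lt (by omega)]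
      have := hle (n - k + j)
      have := hle j
      omega
  refine ⟨periodicApprox_le hle n, ?_, fun k hk => ?_, fun k hk => ?_⟩
  · rw [periodicApprox_of_lt (by omega), hc.zero]
  · rcases lt_or_ge k n with hkn | hkn
    · obtain ⟨j, hj, hlt⟩ := hc.shift_lt k hk
      dsimp only at hj hlt
      rcases lt_or_ge (k + j) n with hjn | hjn
      · refine ⟨j, fun i hi => ?_, ?_⟩
        · dsimp only
          rw [periodicApprox_of_lt (by omega), periodicApprox_of_lt (by omega), hj i hi]
        · dsimp only
          rwa [periodicApprox_of_lt (by omega), periodicApprox_of_lt (by omega)]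
      · obtain ⟨j', hj', heq, hlt'⟩ := hsuf k hk hkn
        refine ⟨n - k + j', fun i hi => ?_, ?_⟩
        · dsimp only
          rcases lt_or_ge (k + i) n with hin | hin
          · rw [periodicApprox_of_lt (by omega), periodicApprox_of_lt (by omega),
              hj i (by omega)]
          · obtain ⟨i', rfl⟩ := Nat.exists_eq_add_of_le (show n - k ≤ i by omega)
            rw [← heq i' (by omega), show k + (n - k + i') = n + i' by omega, periodicApprox_add]
        · dsimp only
          rwa [show k + (n - k + j') = n + j' by omega, periodicApprox_add]
    · obtain ⟨s, rfl⟩ := Nat.exists_eq_add_of_le hkn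
      have hshift : ∀ i, periodicApprox M c n (n + s + i)
          = M - loweredPeriod c n (s % n + i) := fun i => by
        rw [add_assoc, periodicApprox_add, loweredPeriod_mod_add]
      simp only [hshift]
      have hrn : s % n < n := Nat.mod_lt _ (by omega)
      generalize s % n = r at hrn
      rcases Nat.eq_zero_or_pos r with rfl | hr
      · refine ⟨0, by simp, ?_⟩
        dsimp only
        rw [loweredPeriod_of_lt (by omega), periodicApprox_of_lt (by omega)]
        simp only [add_zero, hc.zero]
        omega
      · obtain ⟨j, hj, heq, hlt⟩ := hgood r hr hrn
        have hpre : ∀ i < j, M - loweredPeriod c n (r + i) = periodicApprox M c n i := by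
          intro i hi
          rw [loweredPeriod_of_lt (by omega), periodicApprox_of_lt (by omega), heq i hi]
        by_cases hjn : r + j + 1 < n
        · refine ⟨j, hpre, ?_⟩
          dsimp only
          rwa [loweredPeriod_of_lt hjn, periodicApprox_of_lt (by omega)]
        · have hjn' : r + j + 1 = n := by omega
          have hval : M - loweredPeriod c n (r + j) ≤ periodicApprox M c n j := by
            rw [loweredPeriod_last hjn', periodicApprox_of_lt (by omega)]
            omega
          rcases hval.lt_or_eq with h | h
          · exact ⟨j, hpre, h⟩
          · -- lowering the last digit made the two words equal; the next block decides
            obtain ⟨j', hj', heq', hlt'⟩ := hsuf r hr hrn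
            refine ⟨n - r + j', fun i hi => ?_, ?_⟩
            · dsimp only
              rcases lt_trichotomy i j with hij | rfl | hij
              · exact hpre i hij
              · exact h
              · obtain ⟨i', rfl⟩ := Nat.exists_eq_add_of_le (show n - r ≤ i by omega)
                rw [← heq' i' (by omega), show r + (n - r + i') = n + i' by omega,
                  loweredPeriod_add_right]
            · dsimp only
              rwa [show r + (n - r + j') = n + j' by omega, loweredPeriod_add_right]
  · rcases lt_or_ge k n with hkn | hkn
    · obtain ⟨j, hj, heq, hlt⟩ := hgood k hk hkn
      refine ⟨j, fun i hi => ?_, ?_⟩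
      · dsimp only
        rw [periodicApprox_of_lt (by omega), periodicApprox_of_lt (by omega), heq i hi]
      · dsimp only
        rwa [periodicApprox_of_lt (by omega), periodicApprox_of_lt (by omega)]
    · obtain ⟨s, rfl⟩ := Nat.exists_eq_add_of_le hkn
      have hshift : ∀ i, M - periodicApprox M c n (n + s + i)
          = loweredPeriod c n (s % n + i) := fun i => by
        rw [add_assoc, periodicApprox_add, loweredPeriod_mod_add,
          Nat.sub_sub_self (loweredPeriod_le hle n _)]
      simp only [hshift]
      have hrn : s % n < n := Nat.mod_lt _ (by omega)
      generalize s % n = r at hrn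
      -- the lowered suffix is strictly smaller than the prefix of the same length
      have key : ∀ j, r + j < n → (∀ i < j, c (r + i) = c i) →
          (c (r + j) < c j ∨ (r + j + 1 = n ∧ c (r + j) ≤ c j)) →
          LexLt (fun i => loweredPeriod c n (r + i)) (periodicApprox M c n) := by
        intro j hj heq h
        refine ⟨j, fun i hi => ?_, ?_⟩
        · dsimp only
          rw [loweredPeriod_of_lt (by omega), periodicApprox_of_lt (by omega), heq i hi]
        · dsimp only
          rw [periodicApprox_of_lt (by omega)]
          by_cases hjn : r + j + 1 = n
          · rw [loweredPeriod_last hjn]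
            rw [show n - 1 = r + j by omega] at hlast
            omega
          · rw [loweredPeriod_of_lt (by omega)]
            omega
      rcases Nat.eq_zero_or_pos r with rfl | hr
      · exact key (n - 1) (by omega) (by simp) (Or.inr ⟨by omega, by simp⟩)
      · obtain ⟨j, hj, hlt⟩ := hc.shift_lt r hr
        dsimp only at hj hlt
        rcases lt_or_ge (r + j) n with hjn | hjn
        · exact key j hjn hj (Or.inl hlt)
        · exact key (n - 1 - r) (by omega) (fun i hi => hj i (by omega))
            (Or.inr ⟨by omega, (hj (n - 1 - r) (by omega)).le⟩)

end Approximation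

/-! ### Algebraicity -/

section Algebraic

open Polynomial

/-- With `A` and `B` the values of the first and the second block of length `n`, multiplied by
`q ^ n`, periodicity says that `(q ^ n - A) * (q ^ n - 1) = B`, where `A` and `B` are polynomials in
`q` of degree less than `n`. -/
theorem isAlgebraic_of_periodic {q : ℝ} {M : ℕ} {c : ℕ → ℕ} (hq : 1 < q) (hc : ∀ i, c i ≤ M)
    (hc1 : digitVal q c = 1) {n : ℕ} (hn : 1 ≤ n) (hper : ∀ i, c (n + (n + i)) = c (n + i)) :
    IsAlgebraic ℚ q := by
  have h0 : 0 < q := by linarith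
  let P : (ℕ → ℕ) → ℚ[X] := fun a => ∑ i ∈ range n, C (a i : ℚ) * X ^ (n - 1 - i)
  have hdeg : ∀ a, (P a).degree < n := by
    intro a
    rw [← mem_degreeLT]
    refine Submodule.sum_mem _ fun i hi => ?_
    rw [mem_degreeLT]
    refine (degree_C_mul_X_pow_le _ _).trans_lt ?_
    exact_mod_cast (by omega : n - 1 - i < n)
  have hev : ∀ a, aeval q (P a) = q ^ n * ∑ i ∈ range n, (a i : ℝ) / q ^ (i + 1) := by
    intro a
    simp only [P, map_sum, map_mul, aeval_C, map_pow, aeval_X, mul_sum]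
    refine sum_congr rfl fun i hi => ?_
    have hi := mem_range.1 hi
    rw [show q ^ n = q ^ (n - 1 - i) * q ^ (i + 1) by rw [← pow_add]; congr 1; omega]
    simp only [map_natCast]
    field_simp
  have s1 := digitVal_split hq hc n
  have s2 := digitVal_split (c := fun i => c (n + i)) hq (fun i => hc _) n
  simp only [hper] at s2
  have hm1 : (X ^ n - P c : ℚ[X]).Monic := (monic_X_pow n).sub_of_left (by
    rw [degree_X_pow]; exact hdeg c)
  have hm2 : (X ^ n - 1 : ℚ[X]).Monic := monic_X_pow_sub_C 1 (by omega)
  refine ⟨(X ^ n - P c) * (X ^ n - 1) - P (fun i => c (n + i)), ?_, ?_⟩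
  · refine ((hm1.mul hm2).sub_of_left ?_).ne_zero
    rw [degree_mul, degree_sub_eq_left_of_degree_lt (by rw [degree_X_pow]; exact hdeg c),
      degree_X_pow, ← C_1, degree_X_pow_sub_C (by omega)]
    refine (hdeg _).trans_le ?_
    exact_mod_cast Nat.le_add_left n n
  · simp only [map_sub, map_mul, map_pow, aeval_X, map_one, hev]
    rw [hc1] at s1
    generalize ∑ i ∈ range n, (c i : ℝ) / q ^ (i + 1) = A at *
    generalize ∑ i ∈ range n, (c (n + i) : ℝ) / q ^ (i + 1) = B at *
    generalize digitVal q (fun i => c (n + i)) = v at *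
    have hQ : q ^ n ≠ 0 := (pow_pos h0 n).ne'
    generalize q ^ n = Q at *
    field_simp at s1 s2
    have hA : Q - Q * A = v := by linarith
    rw [hA]
    linarith

end Algebraic

/-! ### Density -/

section Density

theorem digitVal_strictAnti {M : ℕ} {c : ℕ → ℕ} (hc : ∀ i, c i ≤ M) (hc0 : 0 < c 0) {a b : ℝ}
    (ha : 1 < a) (hab : a < b) : digitVal b c < digitVal a c := by
  have h0 : 0 < a := by linarith
  have hb : 0 < b := by linarith
  have hc0' : (0 : ℝ) < c 0 := by exact_mod_cast hc0
  refine Summable.tsum_lt_tsum (i := 0) (fun i => ?_) ?_ (summable_digits (ha.trans hab) hc)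
    (summable_digits ha hc)
  · gcongr
  · simp only [zero_add, pow_one]
    gcongr

theorem continuousOn_digitVal {M : ℕ} {c : ℕ → ℕ} (hc : ∀ i, c i ≤ M) {a b : ℝ} (ha : 1 < a) :
    ContinuousOn (fun x => digitVal x c) (Set.Icc a b) := by
  have h0 : 0 < a := by linarith
  refine continuousOn_tsum (fun i => ?_) (summable_digits ha hc) fun i x hx => ?_
  · refine continuousOn_const.div (by fun_prop) fun x hx => ?_
    have : 0 < x := h0.trans_le hx.1
    positivity
  · have : 0 < x := h0.trans_le hx.1
    rw [Real.norm_of_nonneg (by positivity)]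
    gcongr
    exact hx.1

theorem eventually_digitVal_near {q : ℝ} (hq : 1 < q) (M : ℕ) {ε : ℝ} (hε : 0 < ε) :
    ∀ᶠ n in atTop, ∀ a b : ℕ → ℕ, (∀ i, a i ≤ M) → (∀ i, b i ≤ M) → (∀ i < n, a i = b i) →
      |digitVal q a - digitVal q b| < ε := by
  have h0 : 0 < q := by linarith
  have hlim : Tendsto (fun t : ℕ => M / (q - 1) / q ^ t) atTop (𝓝 0) :=
    tendsto_const_nhds.div_atTop (tendsto_pow_atTop_atTop_of_one_lt hq)
  filter_upwards [hlim.eventually (gt_mem_nhds hε)] with n hn a b ha hb hab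
  refine lt_of_le_of_lt ?_ hn
  rw [digitVal_sub_of_agree hq ha hb hab, abs_div, abs_of_pos (pow_pos h0 n)]
  gcongr
  have h1 := digitVal_le (c := fun i => a (n + i)) hq (fun i => ha _)
  have h2 := digitVal_le (c := fun i => b (n + i)) hq (fun i => hb _)
  have h3 : 0 ≤ digitVal q (fun i => a (n + i)) := digitVal_nonneg hq
  have h4 : 0 ≤ digitVal q (fun i => b (n + i)) := digitVal_nonneg hq
  rw [abs_le]
  constructor <;> linarith

theorem exists_algebraicUnivoque_mem_Ioo {q : ℝ} (hq : q ∈ univoque) {l u : ℝ} (hl : l < q)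
    (hu : q < u) : ∃ x ∈ Set.Ioo l u, x ∈ algebraicUnivoque := by
  obtain ⟨h1, c, hcE, huniq⟩ := id hq
  obtain ⟨M, hM⟩ : ∃ M, M = ⌊q⌋₊ := ⟨_, rfl⟩
  have hMq : (M : ℝ) < q := by
    refine lt_of_le_of_ne (hM ▸ Nat.floor_le (by linarith)) fun h => ?_
    rw [← h] at hq
    exact not_univoque_natCast hq
  have hqM : q < M + 1 := hM ▸ Nat.lt_floor_add_one q
  have hM1 : 1 ≤ M := hM ▸ Nat.le_floor (by simpa using h1)
  have hM1' : (1 : ℝ) ≤ M := by exact_mod_cast hM1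
  have hq1 : 1 < q := by linarith
  have hc := lexAdmissible_of_unique hM1 hMq hqM hcE huniq
  have hc1 := ((isExpansion_iff hq1 hMq hqM).1 hcE).2
  obtain ⟨a, hla, haq⟩ := exists_between (max_lt hl hMq)
  obtain ⟨b, hqb, hbu⟩ := exists_between (lt_min hu hqM)
  obtain ⟨hla, hMa⟩ := max_lt_iff.1 hla
  obtain ⟨hbu, hbM⟩ := lt_min_iff.1 hbu
  have ha1 : 1 < a := by linarith
  have hc0 : 0 < c 0 := by rw [hc.zero]; omega
  have hva := digitVal_strictAnti hc.le hc0 ha1 haq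
  have hvb := digitVal_strictAnti hc.le hc0 hq1 hqb
  rw [hc1] at hva hvb
  obtain ⟨N, hN⟩ := eventually_atTop.1 ((eventually_digitVal_near ha1 M (sub_pos.2 hva)).and
    (eventually_digitVal_near (hq1.trans hqb) M (sub_pos.2 hvb)))
  obtain ⟨n, hn, hgood⟩ := exists_goodPrefix hc (max N 2)
  have hn2 : 2 ≤ n := (le_max_right _ _).trans hn
  obtain ⟨hna, hnb⟩ := hN n ((le_max_left _ _).trans hn)
  have hd := lexAdmissible_periodicApprox hM1 hc hn2 hgood
  have hagree : ∀ i < n, periodicApprox M c n i = c i := fun i hi => periodicApprox_of_lt hi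
  have hna := (abs_lt.1 (hna _ _ hd.le hc.le hagree)).1
  have hnb := (abs_lt.1 (hnb _ _ hd.le hc.le hagree)).2
  obtain ⟨x, hx, hx1⟩ := intermediate_value_Icc' (haq.trans hqb).le
    (continuousOn_digitVal hd.le (b := b) ha1)
    (show (1 : ℝ) ∈ Set.Icc _ _ from ⟨by linarith, by linarith⟩)
  have hx1 : digitVal x (periodicApprox M c n) = 1 := hx1
  obtain ⟨hax, hxb⟩ := hx
  refine ⟨x, ⟨by linarith, by linarith⟩,
    univoque_of_lexAdmissible hM1 (by linarith) (by linarith) hd hx1,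
    isAlgebraic_of_periodic (by linarith) hd.le hx1 (n := n) (by omega) fun i => ?_⟩
  rw [periodicApprox_add, periodicApprox_add, loweredPeriod_add_right]

end Density

theorem theorem1p1 :
    Dense {x : ↥(closure univoque) | (x : ℝ) ∈ algebraicUnivoque} := by
  rw [Subtype.dense_iff]
  refine closure_minimal (fun q hq => ?_) isClosed_closure
  rw [mem_closure_iff_nhds_basis (nhds_basis_Ioo q)]
  rintro ⟨l, u⟩ ⟨hl, hu⟩
  obtain ⟨x, hx, hxA⟩ := exists_algebraicUnivoque_mem_Ioo hq hl hu
  exact ⟨x, ⟨⟨x, subset_closure hxA.1⟩, hxA, rfl⟩, hx⟩
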